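/- Let $G$ be a second countable, locally compact (Hausdorff) unimodular group with Haar measure $\mu_G$. Let $(\pi,\mathcal H_\pi)$ be a discrete series $\sigma$-representation of $G$ on a separable complex Hilbert space $\mathcal H_\pi\neq 0$. That is, $\pi:G\to\mathcal U(\mathcal H_\pi)$ and $\sigma:G\times G\to\mathbb T$ are maps such that $\pi(e_G)=\mathrm{id}$, $\pi(x)\pi(y)=\sigma(x,y)\pi(xy)$ for all $x,y\in G$, and $x\mapsto\langle f,\pi(x)g\rangle$ is Borel measurable for all $f,g\in\mathcal H_\pi$; moreover $\pi$ is irreducible (the only closed $\pi(G)$-invariant subspaces are $0$ and $\mathcal H_\pi$) and square-integrable (there is $g\neq0$ with $\int_G|\langle g,\pi(x)g\rangle|^2\,d\mu_G(x)<\infty$). Let $\Gamma\le G$ be a lattice, i.e. a discrete subgroup such that $G/\Gamma$ admits a nonzero finite $G$-invariant Radon measure, and let $\pi(\Gamma)''\subseteq\mathcal B(\mathcal H_\pi)$ be the bicommutant of $\pi(\Gamma)$. Let $\eta\in\mathcal H_\pi\setminus\{0\}$ be such that its projective stabilizer $$\Gamma_{[\eta]}=\{\gamma\in\Gamma:\pi(\gamma)\eta\in\mathbb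 C\eta\}$$ (a subgroup of $\Gamma$) is finite. Let $u:\Gamma_{[\eta]}\to\mathbb C$ be the function with $\pi(\gamma)\eta=u(\gamma)\eta$ for $\gamma\in\Gamma_{[\eta]}$, and put $$p_\eta=\frac1{|\Gamma_{[\eta]}|}\sum_{\gamma\in\Gamma_{[\eta]}}\overline{u(\gamma)}\,\pi(\gamma).$$ Let $\Lambda_\eta\subseteq\Gamma$ be a set of representatives of the cosets $\Gamma/\Gamma_{[\eta]}$. Suppose that $(\pi(\gamma)\eta)_{\gamma\in\Lambda_\eta}$ is a Riesz sequence in $\mathcal H_\pi$, i.e. there are constants $0<A\le B<\infty$ such that for every $c\in\ell^2(\Lambda_\eta)$ the series $\sum_{\gamma\in\Lambda_\eta}c_\gamma\pi(\gamma)\eta$ converges unconditionally and $$A\|c\|_{\ell^2}^2\le\Big\|\sum_{\gamma\in\Lambda_\eta}c_\gamma\pi(\gamma)\eta\Big\|^2\le B\|c\|_{\ell^2}^2 .$$ Then $\eta$ is a $p_\eta$-separating vector for $\pi(\Gamma)''$: the operator $p_\eta$ is an orthogonal projection belonging to $\pi(\Gamma)''$, $\eta\in p_\eta\mathcal H_\pi$,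 and every $a\in\pi(\Gamma)''p_\eta$ with $a\eta=0$ satisfies $a=0$. -/

import Mathlib

open MeasureTheory Topology

noncomputable section

namespace RieszSep

/-- A `σ`-representation of `G` on the Hilbert space `H`: a weakly Borel measurable map `π` into the
unitary group with `π(1) = 1` and `π(x) π(y) = σ(x,y) π(xy)`. The cocycle identities for `σ` are
consequences (when `H ≠ 0`), so they are not repeated as fields. -/
structure SigmaRep (G : Type*) [Group G] [MeasurableSpace G] (σ : G → G → Circle)
    (H : Type*) [NormedAddCommGroup H] [InnerProductSpace ℂ H] [CompleteSpace H] where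
  /-- the underlying map into the unitary group -/
  toFun : G → unitary (H →L[ℂ] H)
  map_one' : toFun 1 = 1
  map_mul' : ∀ x y : G, (toFun x : H →L[ℂ] H) * (toFun y : H →L[ℂ] H)
    = (σ x y : ℂ) • (toFun (x * y) : H →L[ℂ] H)
  measurable' : ∀ f g : H, Measurable fun x : G => inner ℂ f ((toFun x : H →L[ℂ] H) g)

/-- A lattice: a discrete subgroup `Γ` such that `G ⧸ Γ` admits a finite (nonzero) `G`-invariant
Radon measure. -/
def IsLattice {G : Type*} [Group G] [TopologicalSpace G] (Γ : Subgroup G) : Prop :=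
  letI : MeasurableSpace (G ⧸ Γ) := borel (G ⧸ Γ)
  DiscreteTopology Γ ∧ ∃ ν : Measure (G ⧸ Γ),
    ν ≠ 0 ∧ IsFiniteMeasure ν ∧ ν.Regular ∧ SMulInvariantMeasure G (G ⧸ Γ) ν

section

variable {H : Type*} [NormedAddCommGroup H] [InnerProductSpace ℂ H]

/-- `(v i)` is a Riesz sequence: for all `c ∈ ℓ²` the series `∑ c i • v i` converges and its norm
is comparable to that of `c`. -/
def IsRieszSequence {ι : Type*} (v : ι → H) : Prop :=
  ∃ A B : ℝ, 0 < A ∧ A ≤ B ∧ ∀ c : lp (fun _ : ι => ℂ) 2,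
    Summable (fun i => c i • v i) ∧
    A * ‖c‖ ^ 2 ≤ ‖∑' i, c i • v i‖ ^ 2 ∧ ‖∑' i, c i • v i‖ ^ 2 ≤ B * ‖c‖ ^ 2

/-- `η` is `p`-separating for the von Neumann algebra `M`: here `p` is a projection in `M`, the
vector `η` lies in `pH`, and `a ∈ Mp`, `a η = 0` imply `a = 0`. -/
def IsSeparatingFor [CompleteSpace H] (M : VonNeumannAlgebra H) (p : H →L[ℂ] H) (η : H) : Prop :=
  IsStarProjection p ∧ p ∈ M ∧ η ∈ Set.range p ∧
    ∀ a : H →L[ℂ] H, (∃ b ∈ M, a = b * p) → a η = 0 → a = 0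

end

namespace SigmaRep

variable {G : Type*} [Group G] [MeasurableSpace G] {σ : G → G → Circle}
  {H : Type*} [NormedAddCommGroup H] [InnerProductSpace ℂ H] [CompleteSpace H]

/-- The operator `π(x)` on `H`. -/
def op (π : SigmaRep G σ H) (x : G) : H →L[ℂ] H := (π.toFun x : H →L[ℂ] H)

theorem op_one (π : SigmaRep G σ H) : π.op 1 = 1 := by
  simp [op, π.map_one']

theorem op_mul (π : SigmaRep G σ H) (x y : G) :
    π.op x * π.op y = (σ x y : ℂ) • π.op (x * y) := π.map_mul' x y

theorem op_mul' (π : SigmaRep G σ H) (x y : G) :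
    π.op (x * y) = ((σ x y : ℂ))⁻¹ • (π.op x * π.op y) := by
  rw [op_mul, smul_smul, inv_mul_cancel₀ (Circle.coe_ne_zero _), one_smul]

theorem star_op (π : SigmaRep G σ H) (x : G) :
    star (π.op x) = ((σ x x⁻¹ : ℂ))⁻¹ • π.op x⁻¹ := by
  have h1 : star (π.op x) * π.op x = 1 := Unitary.coe_star_mul_self (π.toFun x)
  have h2 : π.op x * (((σ x x⁻¹ : ℂ))⁻¹ • π.op x⁻¹) = 1 := by
    rw [mul_smul_comm, ← op_mul', mul_inv_cancel, op_one]
  exact left_inv_eq_right_inv h1 h2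

/-- `π` is irreducible: `H ≠ 0` and the only closed `π(G)`-invariant subspaces are `0` and `H`. -/
def IsIrreducible (π : SigmaRep G σ H) : Prop :=
  Nontrivial H ∧ ∀ K : Submodule ℂ H, IsClosed (K : Set H) →
    (∀ x : G, ∀ f ∈ K, π.op x f ∈ K) → K = ⊥ ∨ K = ⊤

/-- `π` is square-integrable: some nonzero `η` has a square-integrable diagonal matrix
coefficient. -/
def IsSquareIntegrable (π : SigmaRep G σ H) (μ : Measure G) : Prop :=
  ∃ η : H, η ≠ 0 ∧ Integrable (fun x : G => ‖inner ℂ η (π.op x η)‖ ^ 2) μ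

/-- A discrete series `σ`-representation: irreducible and square-integrable. -/
def IsDiscreteSeries (π : SigmaRep G σ H) (μ : Measure G) : Prop :=
  π.IsIrreducible ∧ π.IsSquareIntegrable μ

/-- The projective stabilizer `Γ_[η] = {γ ∈ Γ : π(γ) η ∈ ℂ η}`, a subgroup of `Γ`. -/
def projStabilizer (π : SigmaRep G σ H) (Γ : Subgroup G) (η : H) : Subgroup Γ where
  carrier := {γ | ∃ z : ℂ, π.op γ η = z • η}
  one_mem' := ⟨1, by simp [op_one]⟩
  mul_mem' := by
    rintro x y ⟨a, ha⟩ ⟨b, hb⟩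
    refine ⟨((σ x y : ℂ))⁻¹ * (b * a), ?_⟩
    simp [op_mul', ha, hb, smul_smul]
  inv_mem' := by
    rintro x ⟨a, ha⟩
    have h1 : π.op x⁻¹ (π.op x η) = (σ (x : G)⁻¹ x : ℂ) • η := by
      have := congrArg (fun T : H →L[ℂ] H => T η) (π.op_mul (x : G)⁻¹ x)
      simpa [op_one] using this
    rw [ha, map_smul] at h1
    by_cases h0 : a = 0
    · have h2 : η = 0 := by
        rw [h0, zero_smul] at h1
        exact (smul_eq_zero.1 h1.symm).resolve_left (Circle.coe_ne_zero _)
      exact ⟨0, by simp [h2]⟩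
    · refine ⟨a⁻¹ * (σ (x : G)⁻¹ x : ℂ), ?_⟩
      rw [mul_smul, ← h1, smul_smul, inv_mul_cancel₀ h0, one_smul]
      rfl

/-- `π(Γ)''`, the bicommutant of `π(Γ)`, as a von Neumann algebra. -/
def vonNeumann (π : SigmaRep G σ H) (Γ : Subgroup G) : VonNeumannAlgebra H where
  carrier := Set.centralizer (Set.centralizer (π.op '' (Γ : Set G)))
  mul_mem' := Set.mul_mem_centralizer
  one_mem' := Set.one_mem_centralizer
  add_mem' := Set.add_mem_centralizer
  zero_mem' := Set.zero_mem_centralizer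
  algebraMap_mem' := fun r _ _ => (Algebra.commutes r _).symm
  star_mem' := by
    intro a ha m hm
    have hm' : star m ∈ Set.centralizer (π.op '' (Γ : Set G)) := by
      rintro _ ⟨x, hx, rfl⟩
      have h := hm (π.op x⁻¹) ⟨x⁻¹, Γ.inv_mem hx, rfl⟩
      have h2 : star (π.op x) * m = m * star (π.op x) := by
        rw [star_op, smul_mul_assoc, mul_smul_comm, h]
      have h3 := congrArg star h2
      simpa using h3.symm
    have h := congrArg star (ha (star m) hm')
    simpa using h.symm
  centralizer_centralizer' := Set.centralizer_centralizer_centralizer _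

/-- `|Γ_[η]|⁻¹ ∑_{γ ∈ Γ_[η]} conj (u(γ)) π(γ)`; the sum is an honest finite sum when `Γ_[η]` is
finite. -/
def avgProjection (π : SigmaRep G σ H) (Γ : Subgroup G) (η : H)
    (u : π.projStabilizer Γ η → ℂ) : H →L[ℂ] H :=
  ((Nat.card (π.projStabilizer Γ η) : ℂ))⁻¹ •
    ∑ᶠ γ : π.projStabilizer Γ η, (starRingEnd ℂ (u γ)) • π.op ((γ : Γ) : G)

end SigmaRep

end RieszSep

end

/-! Write `p` for the averaging projection. If `b` lies in `π(Γ)''` and `b p η = 0`, then `b η = 0`,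
because `p η = η`. Any `T` in the commutant then gives `b (T η) = T (b η) = 0`, so it suffices that
the vectors `T η` span a dense subspace of the range of `p`.

Operators in the commutant come from the Riesz property. If `v` has a Bessel orbit under `Γ`, so
does `p v` (`isBessel_op_avgProjection`), and the stabilizer acts on `p v` by the same scalars as on
`η`. The lower Riesz bound gives a bounded `T` that sends `π(γ) η` to `π(γ) p v` on coset
representatives and vanishes on their orthogonal complement (`IsRieszSequence.exists_map_eq`).
Equality of the scalars extends this to all of `Γ`, so `T` commutes with `π(Γ)` and `T η = p v`
(`exists_commutant_map_eq`). Hence `b p v = 0`.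

It remains to see that Bessel vectors are total (`IsDiscreteSeries.eq_zero_of_forall_isBessel`).
Square-integrability yields some `g ≠ 0` with a bounded coefficient operator into `L²`
(`IsSquareIntegrable.exists_bounded`). The weak integral of `π(x) g` over a small set with disjoint
`Γ`-translates is Bessel. A vector orthogonal to all these integrals has a coefficient against `g`
that vanishes almost everywhere, hence is zero by irreducibility. -/

noncomputable section

namespace RieszSep

/-! ### Bessel families, Riesz sequences and operators between their spans. -/

section Bessel

variable {H : Type*} [NormedAddCommGroup H] [InnerProductSpace ℂ H] {ι κ : Type*}

/-- `(w i)` is a Bessel family: the coefficients `⟪w i, f⟫` are square-summable, with a bound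
proportional to `‖f‖ ^ 2`. -/
def IsBessel (w : ι → H) : Prop :=
  ∃ C : ℝ, ∀ (f : H) (s : Finset ι), ∑ i ∈ s, ‖inner ℂ (w i) f‖ ^ 2 ≤ C * ‖f‖ ^ 2

theorem IsBessel.add {v w : ι → H} (hv : IsBessel v) (hw : IsBessel w) :
    IsBessel fun i => v i + w i := by
  obtain ⟨C, hC⟩ := hv
  obtain ⟨D, hD⟩ := hw
  refine ⟨2 * C + 2 * D, fun f s => ?_⟩
  calc ∑ i ∈ s, ‖inner ℂ (v i + w i) f‖ ^ 2
      ≤ ∑ i ∈ s, (2 * ‖inner ℂ (v i) f‖ ^ 2 + 2 * ‖inner ℂ (w i) f‖ ^ 2) := by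
        refine Finset.sum_le_sum fun i _ => ?_
        rw [inner_add_left]
        have h := norm_add_le (inner ℂ (v i) f) (inner ℂ (w i) f)
        nlinarith [norm_nonneg (inner ℂ (v i) f + inner ℂ (w i) f),
          sq_nonneg (‖inner ℂ (v i) f‖ - ‖inner ℂ (w i) f‖),
          norm_nonneg (inner ℂ (v i) f), norm_nonneg (inner ℂ (w i) f)]
    _ = 2 * ∑ i ∈ s, ‖inner ℂ (v i) f‖ ^ 2 + 2 * ∑ i ∈ s, ‖inner ℂ (w i) f‖ ^ 2 := by
        rw [Finset.sum_add_distrib, Finset.mul_sum, Finset.mul_sum]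
    _ ≤ (2 * C + 2 * D) * ‖f‖ ^ 2 := by
        linarith [hC f s, hD f s]

theorem isBessel_zero : IsBessel fun _ : ι => (0 : H) :=
  ⟨0, fun f s => by simp⟩

theorem IsBessel.sum {t : Finset κ} {w : κ → ι → H} (h : ∀ k ∈ t, IsBessel (w k)) :
    IsBessel fun i => ∑ k ∈ t, w k i := by
  classical
  induction t using Finset.induction_on with
  | empty => simpa using isBessel_zero
  | insert k t hk ih =>
    simp only [Finset.sum_insert hk]
    exact (h k (Finset.mem_insert_self k t)).add
      (ih fun j hj => h j (Finset.mem_insert_of_mem hj))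

/-- Reindexing a Bessel family along an injection and multiplying by bounded scalars. -/
theorem IsBessel.smul_comp {w : ι → H} (hw : IsBessel w) {e : κ → ι}
    (he : Function.Injective e) {z : κ → ℂ} {K : ℝ} (hz : ∀ k, ‖z k‖ ≤ K) :
    IsBessel fun k => z k • w (e k) := by
  obtain ⟨C, hC⟩ := hw
  refine ⟨K ^ 2 * C, fun f s => ?_⟩
  calc ∑ k ∈ s, ‖inner ℂ (z k • w (e k)) f‖ ^ 2
      ≤ ∑ k ∈ s, K ^ 2 * ‖inner ℂ (w (e k)) f‖ ^ 2 := by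
        refine Finset.sum_le_sum fun k _ => ?_
        rw [inner_smul_left, norm_mul, RCLike.norm_conj, mul_pow]
        gcongr
        exact hz k
    _ = K ^ 2 * ∑ i ∈ s.map ⟨e, he⟩, ‖inner ℂ (w i) f‖ ^ 2 := by
        rw [Finset.sum_map, Finset.mul_sum]; rfl
    _ ≤ K ^ 2 * C * ‖f‖ ^ 2 := by
        rw [mul_assoc]
        exact mul_le_mul_of_nonneg_left (hC f _) (sq_nonneg K)

/-- A Riesz sequence has a bounded and bounded below synthesis operator on `ℓ²`. -/
theorem IsRieszSequence.exists_synthesis [DecidableEq ι] {v : ι → H} (hv : IsRieszSequence v) :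
    ∃ U : lp (fun _ : ι => ℂ) 2 →L[ℂ] H, (∀ i, U (lp.single 2 i 1) = v i) ∧
      ∃ A : NNReal, 0 < A ∧ ∀ c, A * ‖c‖ ^ 2 ≤ ‖U c‖ ^ 2 := by
  obtain ⟨A, B, hA, hAB, h⟩ := hv
  let U₀ : lp (fun _ : ι => ℂ) 2 →ₗ[ℂ] H :=
    { toFun := fun c => ∑' i, c i • v i
      map_add' := fun c d => by
        rw [← (h c).1.tsum_add (h d).1]
        simp [add_smul]
      map_smul' := fun r c => by
        simp only [RingHom.id_apply]
        rw [← (h c).1.tsum_const_smul]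
        simp [mul_smul] }
  let U := U₀.mkContinuous (Real.sqrt B) (by
    intro c
    refine Real.le_sqrt_of_sq_le (h c).2.2 |>.trans_eq ?_
    rw [Real.sqrt_mul (hA.le.trans hAB), Real.sqrt_sq (norm_nonneg c)])
  refine ⟨U, fun i => ?_, ⟨A, hA.le⟩, hA, fun c => (h c).2.1⟩
  change ∑' j, (lp.single 2 i (1 : ℂ) : lp (fun _ : ι => ℂ) 2) j • v j = v i
  rw [tsum_eq_single i]
  · simp
  · intro j hj
    simp [hj]

variable [CompleteSpace H]

/-- A Bessel family has a bounded synthesis operator on `ℓ²`. -/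
theorem IsBessel.exists_synthesis [DecidableEq ι] {w : ι → H} (hw : IsBessel w) :
    ∃ U : lp (fun _ : ι => ℂ) 2 →L[ℂ] H, ∀ i, U (lp.single 2 i 1) = w i := by
  obtain ⟨C, hC⟩ := hw
  have hC' : ∀ (f : H) (s : Finset ι),
      ∑ i ∈ s, ‖inner ℂ (w i) f‖ ^ (2 : ENNReal).toReal ≤ C * ‖f‖ ^ 2 := by
    intro f s
    simpa using hC f s
  let A₀ : H →ₗ[ℂ] lp (fun _ : ι => ℂ) 2 :=
    { toFun := fun f => ⟨fun i => inner ℂ (w i) f, memℓp_gen' (hC' f)⟩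
      map_add' := fun f g => by
        ext i
        exact inner_add_right _ _ _
      map_smul' := fun c f => by
        ext i
        exact inner_smul_right _ _ _ }
  have hA₀ : ∀ f i, A₀ f i = inner ℂ (w i) f := fun _ _ => rfl
  -- The Bessel constant is not assumed nonnegative, hence the absolute value.
  let A : H →L[ℂ] lp (fun _ : ι => ℂ) 2 := A₀.mkContinuous (Real.sqrt |C|) (by
    intro f
    refine lp.norm_le_of_forall_sum_le (by norm_num) (by positivity) fun s => ?_
    refine (hC' f s).trans ?_
    rw [ENNReal.toReal_ofNat, Real.rpow_ofNat, mul_pow, Real.sq_sqrt (abs_nonneg C)]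
    gcongr
    exact le_abs_self C)
  -- Synthesis is the adjoint of the analysis operator.
  refine ⟨ContinuousLinearMap.adjoint A, fun i => ext_inner_right ℂ fun f => ?_⟩
  rw [ContinuousLinearMap.adjoint_inner_left, lp.inner_single_left]
  change inner ℂ (1 : ℂ) (A₀ f i) = _
  simp [hA₀]

/-- A Riesz sequence can be mapped to any Bessel family by a bounded operator which vanishes on
its orthogonal complement. -/
theorem IsRieszSequence.exists_map_eq {v w : ι → H} (hv : IsRieszSequence v) (hw : IsBessel w) :
    ∃ T : H →L[ℂ] H, (∀ i, T (v i) = w i) ∧ ∀ f, (∀ i, inner ℂ (v i) f = 0) → T f = 0 := by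
  classical
  obtain ⟨U, hU, A, hA, hUA⟩ := hv.exists_synthesis
  obtain ⟨W, hW⟩ := hw.exists_synthesis
  have hunit : IsUnit (U.adjoint ∘L U) := by
    refine ContinuousLinearMap.isUnit_of_forall_le_norm_inner_map _ hA fun c => ?_
    rw [ContinuousLinearMap.comp_apply, ContinuousLinearMap.adjoint_inner_left,
      inner_self_eq_norm_sq_to_K, mul_comm]
    simpa using hUA c
  obtain ⟨N, hN⟩ := hunit
  -- The factor `(U* U)⁻¹ U*` is a left inverse of `U` that kills the orthogonal complement of its
  -- range.
  refine ⟨W ∘L (N⁻¹).val ∘L U.adjoint, fun i => ?_, fun f hf => ?_⟩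
  · have h : (N⁻¹).val (U.adjoint (U (lp.single 2 i 1))) = lp.single 2 i 1 := by
      have h1 := congrArg (fun S : lp (fun _ : ι => ℂ) 2 →L[ℂ] lp (fun _ : ι => ℂ) 2 =>
        S (lp.single 2 i 1)) N.inv_mul
      rw [hN] at h1
      exact h1
    rw [← hU i, ← hW i]
    simp only [ContinuousLinearMap.comp_apply]
    rw [h]
  · have h : U.adjoint f = 0 := by
      ext i
      have h1 : inner ℂ (lp.single 2 i (1 : ℂ)) (U.adjoint f) = 0 := by
        rw [ContinuousLinearMap.adjoint_inner_right, hU, hf]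
      rw [lp.inner_single_left] at h1
      simpa using h1
    simp [h]

/-- Two bounded operators agreeing on a family and on its orthogonal complement are equal. -/
theorem clm_eq_of_eqOn_of_eqOn_orthogonal {S T : H →L[ℂ] H} {v : ι → H}
    (h : ∀ i, S (v i) = T (v i))
    (h' : ∀ f, (∀ i, inner ℂ (v i) f = 0) → S f = T f) : S = T := by
  let K : Submodule ℂ H := (Submodule.span ℂ (Set.range v)).topologicalClosure
  have : CompleteSpace K :=
    (Submodule.isClosed_topologicalClosure _).completeSpace_coe
  have hvK : ∀ i, v i ∈ K := fun i =>
    Submodule.le_topologicalClosure _ (Submodule.subset_span ⟨i, rfl⟩)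
  have hK : K ≤ LinearMap.ker ((S - T : H →L[ℂ] H) : H →ₗ[ℂ] H) := by
    refine Submodule.topologicalClosure_minimal _ ?_ (S - T).isClosed_ker
    rw [Submodule.span_le]
    rintro _ ⟨i, rfl⟩
    simp [h i]
  ext f
  have h1 : S (K.starProjection f) = T (K.starProjection f) := by
    have := hK (K.starProjection_apply_mem f)
    simpa [sub_eq_zero] using this
  have h2 : S (f - K.starProjection f) = T (f - K.starProjection f) :=
    h' _ fun i => K.sub_starProjection_mem_orthogonal f (v i) (hvK i)
  rw [map_sub, map_sub, h1] at h2
  exact sub_left_injective h2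

end Bessel

namespace SigmaRep

/-! ### Unitarity and cocycle identities for the operators `π(x)`. -/

section Operators

variable {G : Type*} [Group G] [MeasurableSpace G] {σ : G → G → Circle}
  {H : Type*} [NormedAddCommGroup H] [InnerProductSpace ℂ H] [CompleteSpace H]

theorem star_op_mul_self (π : SigmaRep G σ H) (x : G) : star (π.op x) * π.op x = 1 :=
  Unitary.coe_star_mul_self (π.toFun x)

theorem op_mul_star_self (π : SigmaRep G σ H) (x : G) : π.op x * star (π.op x) = 1 :=
  Unitary.coe_mul_star_self (π.toFun x)

theorem op_op (π : SigmaRep G σ H) (x y : G) (f : H) :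
    π.op x (π.op y f) = (σ x y : ℂ) • π.op (x * y) f :=
  congrArg (fun T : H →L[ℂ] H => T f) (π.op_mul x y)

theorem op_mul_apply (π : SigmaRep G σ H) (x y : G) (f : H) :
    π.op (x * y) f = ((σ x y : ℂ))⁻¹ • π.op x (π.op y f) :=
  congrArg (fun T : H →L[ℂ] H => T f) (π.op_mul' x y)

theorem inner_op_op (π : SigmaRep G σ H) (x : G) (f g : H) :
    inner ℂ (π.op x f) (π.op x g) = inner ℂ f g := by
  rw [← ContinuousLinearMap.adjoint_inner_right, ← ContinuousLinearMap.star_eq_adjoint,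
    ← mul_apply_eq_comp, star_op_mul_self, one_apply_eq_self]

theorem norm_op (π : SigmaRep G σ H) (x : G) (f : H) : ‖π.op x f‖ = ‖f‖ := by
  rw [@norm_eq_sqrt_re_inner ℂ, @norm_eq_sqrt_re_inner ℂ, inner_op_op]

theorem op_surjective (π : SigmaRep G σ H) (x : G) : Function.Surjective (π.op x) := fun f =>
  ⟨star (π.op x) f, by
    rw [← mul_apply_eq_comp, op_mul_star_self, one_apply_eq_self]⟩

theorem inner_op_mul (π : SigmaRep G σ H) (y x : G) (g f : H) :
    inner ℂ (π.op (y * x) g) (π.op y f) = (σ y x : ℂ) * inner ℂ (π.op x g) f := by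
  rw [op_mul_apply, inner_smul_left, inner_op_op, ← Circle.coe_inv, ← Circle.coe_inv_eq_conj,
    inv_inv]

theorem measurable_inner_op (π : SigmaRep G σ H) (g f : H) :
    Measurable fun x : G => inner ℂ (π.op x g) f := by
  have h : Measurable fun x : G => starRingEnd ℂ (inner ℂ f (π.op x g)) :=
    (RCLike.continuous_conj (K := ℂ)).measurable.comp (π.measurable' f g)
  simpa only [inner_conj_symm] using h

end Operators

/-! ### The projective stabilizer, its averaging projection, and the commutant of `π(Γ)`. -/

section Stabilizer

variable {G : Type*} [Group G] [MeasurableSpace G] {σ : G → G → Circle}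
  {H : Type*} [NormedAddCommGroup H] [InnerProductSpace ℂ H] [CompleteSpace H]
  (π : SigmaRep G σ H) {Γ : Subgroup G} {η : H} {u : π.projStabilizer Γ η → ℂ}

theorem norm_eigenvalue (hη : η ≠ 0)
    (hu : ∀ γ : π.projStabilizer Γ η, π.op ((γ : Γ) : G) η = u γ • η)
    (γ : π.projStabilizer Γ η) : ‖u γ‖ = 1 := by
  have h := congrArg norm (hu γ)
  rw [norm_op, norm_smul] at h
  exact (mul_eq_right₀ (norm_ne_zero_iff.2 hη)).1 h.symm

theorem conj_eigenvalue_mul_self (hη : η ≠ 0)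
    (hu : ∀ γ : π.projStabilizer Γ η, π.op ((γ : Γ) : G) η = u γ • η)
    (γ : π.projStabilizer Γ η) : starRingEnd ℂ (u γ) * u γ = 1 := by
  rw [mul_comm, Complex.mul_conj, Complex.normSq_eq_norm_sq, π.norm_eigenvalue hη hu]
  simp

theorem eigenvalue_mul (hη : η ≠ 0)
    (hu : ∀ γ : π.projStabilizer Γ η, π.op ((γ : Γ) : G) η = u γ • η)
    (h k : π.projStabilizer Γ η) :
    (σ ((h : Γ) : G) ((k : Γ) : G) : ℂ) * u (h * k) = u h * u k := by
  have h1 := π.op_op ((h : Γ) : G) ((k : Γ) : G) η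
  have h2 := hu (h * k)
  simp only [Subgroup.coe_mul] at h2
  rw [h2, hu k, map_smul, hu h, smul_smul, smul_smul] at h1
  rw [← smul_left_injective ℂ hη h1, mul_comm]

theorem conj_eigenvalue_mul_cocycle (hη : η ≠ 0)
    (hu : ∀ γ : π.projStabilizer Γ η, π.op ((γ : Γ) : G) η = u γ • η)
    (h k : π.projStabilizer Γ η) :
    starRingEnd ℂ (u k) * (σ ((h : Γ) : G) ((k : Γ) : G) : ℂ)
      = u h * starRingEnd ℂ (u (h * k)) := by
  have h1 := π.eigenvalue_mul hη hu h k
  have h2 := π.conj_eigenvalue_mul_self hη hu k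
  have h3 := π.conj_eigenvalue_mul_self hη hu (h * k)
  calc _ = starRingEnd ℂ (u k) * (σ ((h : Γ) : G) ((k : Γ) : G) * u (h * k))
        * starRingEnd ℂ (u (h * k)) := by
        linear_combination (-starRingEnd ℂ (u k) * (σ ((h : Γ) : G) ((k : Γ) : G) : ℂ)) * h3
    _ = u h * starRingEnd ℂ (u (h * k)) := by
        rw [h1]
        linear_combination (u h * starRingEnd ℂ (u (h * k))) * h2

/-- An operator in the commutant of `π(Γ)` which maps `η` to a prescribed vector `ζ` on which
the stabilizer of `η` acts by the same character. -/
theorem exists_commutant_map_eq {Λ : Set Γ}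
    (hΛ : Subgroup.IsComplement Λ (π.projStabilizer Γ η : Set Γ))
    (hu : ∀ γ : π.projStabilizer Γ η, π.op ((γ : Γ) : G) η = u γ • η)
    (hRiesz : IsRieszSequence fun γ : Λ => π.op ((γ : Γ) : G) η)
    {ζ : H} (hζ : ∀ γ : π.projStabilizer Γ η, π.op ((γ : Γ) : G) ζ = u γ • ζ)
    (hB : IsBessel fun γ : Γ => π.op (γ : G) ζ) :
    ∃ T ∈ Set.centralizer (π.op '' (Γ : Set G)), T η = ζ := by
  have hB' : IsBessel fun γ : Λ => π.op ((γ : Γ) : G) ζ := by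
    simpa using hB.smul_comp (e := fun γ : Λ => (γ : Γ)) Subtype.val_injective
      (z := fun _ => 1) (K := 1) (by simp)
  obtain ⟨T, hT, hT0⟩ := hRiesz.exists_map_eq hB'
  have hdec : ∀ γ : Γ, ∃ (l : Λ) (h : π.projStabilizer Γ η), (l : Γ) * (h : Γ) = γ := fun γ =>
    ⟨(hΛ.equiv γ).1, (hΛ.equiv γ).2, hΛ.equiv_fst_mul_equiv_snd γ⟩
  -- On `γ = l h` both sides acquire the same scalar: the cocycle factor times `u h`.
  have hTγ : ∀ γ : Γ, T (π.op (γ : G) η) = π.op (γ : G) ζ := by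
    intro γ
    obtain ⟨l, h, rfl⟩ := hdec γ
    rw [Subgroup.coe_mul, op_mul_apply, op_mul_apply, hu, hζ]
    simp only [map_smul, hT]
  have horth : ∀ f : H, (∀ l : Λ, inner ℂ (π.op ((l : Γ) : G) η) f = 0) →
      ∀ γ : Γ, inner ℂ (π.op (γ : G) η) f = 0 := by
    intro f hf γ
    obtain ⟨l, h, rfl⟩ := hdec γ
    rw [Subgroup.coe_mul, op_mul_apply, hu]
    simp only [map_smul, inner_smul_left, hf, mul_zero]
  refine ⟨T, ?_, ?_⟩
  · rintro _ ⟨x, hx, rfl⟩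
    lift x to Γ using hx
    refine clm_eq_of_eqOn_of_eqOn_orthogonal (v := fun l : Λ => π.op ((l : Γ) : G) η) ?_ ?_
    · intro l
      change π.op x (T (π.op _ η)) = T (π.op x (π.op _ η))
      rw [hT, op_op, op_op, map_smul, ← Subgroup.coe_mul, hTγ]
    -- The orthogonal complement of the orbit is `Γ`-invariant, so both sides vanish there.
    · intro f hf
      change π.op x (T f) = T (π.op x f)
      rw [hT0 f hf, map_zero, hT0]
      intro l
      have h1 := π.inner_op_mul x ((x⁻¹ * (l : Γ) : Γ) : G) η f
      rw [horth f hf, mul_zero, ← Subgroup.coe_mul, mul_inv_cancel_left] at h1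
      exact h1
  · have := hTγ 1
    simpa [op_one] using this

variable [Fintype (π.projStabilizer Γ η)]

theorem avgProjection_eq_sum : π.avgProjection Γ η u =
    ((Fintype.card (π.projStabilizer Γ η) : ℂ))⁻¹ •
      ∑ γ : π.projStabilizer Γ η, starRingEnd ℂ (u γ) • π.op ((γ : Γ) : G) := by
  rw [avgProjection, finsum_eq_sum_of_fintype, Nat.card_eq_fintype_card]

/-- Left multiplication by `h` permutes the stabilizer, and the weights absorb the cocycle. This
makes every vector in the range transform under the stabilizer exactly as `η` does. -/
theorem op_mul_avgProjection (hη : η ≠ 0)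
    (hu : ∀ γ : π.projStabilizer Γ η, π.op ((γ : Γ) : G) η = u γ • η)
    (h : π.projStabilizer Γ η) :
    π.op ((h : Γ) : G) * π.avgProjection Γ η u = u h • π.avgProjection Γ η u := by
  rw [avgProjection_eq_sum, mul_smul_comm, smul_comm (u h), Finset.mul_sum]
  congr 1
  rw [Finset.smul_sum]
  rw [← Equiv.sum_comp (Equiv.mulLeft h) fun k => u h • (starRingEnd ℂ (u k) • π.op ((k : Γ) : G))]
  refine Finset.sum_congr rfl fun k _ => ?_
  rw [mul_smul_comm, op_mul, smul_smul, smul_smul, π.conj_eigenvalue_mul_cocycle hη hu]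
  rfl

/-- Each summand of the adjoint fixes the projection, so averaging them does too. The identity `p* p
= p` yields self-adjointness and idempotence together. -/
theorem star_avgProjection_mul_self (hη : η ≠ 0)
    (hu : ∀ γ : π.projStabilizer Γ η, π.op ((γ : Γ) : G) η = u γ • η) :
    star (π.avgProjection Γ η u) * π.avgProjection Γ η u = π.avgProjection Γ η u := by
  have key : ∀ h : π.projStabilizer Γ η, star (π.op ((h : Γ) : G)) * π.avgProjection Γ η u
      = starRingEnd ℂ (u h) • π.avgProjection Γ η u := by
    intro h
    have h1 := congrArg (fun T => starRingEnd ℂ (u h) • (star (π.op ((h : Γ) : G)) * T))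
      (π.op_mul_avgProjection hη hu h)
    simp only [mul_smul_comm, smul_smul] at h1
    rw [π.conj_eigenvalue_mul_self hη hu, one_smul, ← mul_assoc, star_op_mul_self, one_mul] at h1
    exact h1.symm
  conv_lhs => arg 1; rw [π.avgProjection_eq_sum]
  rw [star_smul, star_sum, smul_mul_assoc, Finset.sum_mul]
  have h2 : ∀ h : π.projStabilizer Γ η,
      star (starRingEnd ℂ (u h) • π.op ((h : Γ) : G)) * π.avgProjection Γ η u
        = π.avgProjection Γ η u := by
    intro h
    rw [star_smul, smul_mul_assoc, key, smul_smul]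
    have := π.conj_eigenvalue_mul_self hη hu h
    rw [RCLike.star_def, Complex.conj_conj, mul_comm, this, one_smul]
  rw [Finset.sum_congr rfl fun h _ => h2 h, Finset.sum_const, Finset.card_univ,
    ← Nat.cast_smul_eq_nsmul ℂ, smul_smul, star_inv₀, star_natCast, inv_mul_cancel₀, one_smul]
  exact Nat.cast_ne_zero.2 Fintype.card_ne_zero

theorem isStarProjection_avgProjection (hη : η ≠ 0)
    (hu : ∀ γ : π.projStabilizer Γ η, π.op ((γ : Γ) : G) η = u γ • η) :
    IsStarProjection (π.avgProjection Γ η u) := by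
  have h := π.star_avgProjection_mul_self hη hu
  have hs : IsSelfAdjoint (π.avgProjection Γ η u) := by
    rw [← h]
    exact IsSelfAdjoint.star_mul_self _
  refine ⟨?_, hs⟩
  rw [hs.star_eq] at h
  exact h

theorem avgProjection_mem_vonNeumann :
    π.avgProjection Γ η u ∈ Set.centralizer (Set.centralizer (π.op '' (Γ : Set G))) := by
  intro m hm
  rw [avgProjection_eq_sum, mul_smul_comm, smul_mul_assoc, Finset.mul_sum, Finset.sum_mul]
  congr 1
  refine Finset.sum_congr rfl fun h _ => ?_
  rw [mul_smul_comm, smul_mul_assoc, hm _ ⟨_, (h : Γ).2, rfl⟩]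

theorem avgProjection_apply_self (hη : η ≠ 0)
    (hu : ∀ γ : π.projStabilizer Γ η, π.op ((γ : Γ) : G) η = u γ • η) :
    π.avgProjection Γ η u η = η := by
  rw [avgProjection_eq_sum, smul_apply, sum_apply]
  simp only [smul_apply, hu, smul_smul, π.conj_eigenvalue_mul_self hη hu,
    one_smul]
  rw [Finset.sum_const, Finset.card_univ, ← Nat.cast_smul_eq_nsmul ℂ, smul_smul,
    inv_mul_cancel₀, one_smul]
  exact Nat.cast_ne_zero.2 Fintype.card_ne_zero

/-- If the orbit of `v` under `Γ` is Bessel, so is that of the image of `v` under the averaging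
projection. -/
theorem isBessel_op_avgProjection {v : H} (hη : η ≠ 0)
    (hu : ∀ γ : π.projStabilizer Γ η, π.op ((γ : Γ) : G) η = u γ • η)
    (hv : IsBessel fun γ : Γ => π.op (γ : G) v) :
    IsBessel fun γ : Γ => π.op (γ : G) (π.avgProjection Γ η u v) := by
  -- Expanding the average turns the orbit into a finite sum of right translates of the orbit of
  -- `v`, with scalars of constant modulus.
  have h1 : IsBessel fun γ : Γ => ∑ h : π.projStabilizer Γ η,
      (((Fintype.card (π.projStabilizer Γ η) : ℂ))⁻¹ * (starRingEnd ℂ (u h)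
        * (σ (γ : G) ((h : Γ) : G) : ℂ))) • π.op ((γ * (h : Γ) : Γ) : G) v := by
    refine IsBessel.sum fun h _ => hv.smul_comp (e := fun γ => γ * (h : Γ))
      (mul_left_injective (h : Γ))
      (K := ‖((Fintype.card (π.projStabilizer Γ η) : ℂ))⁻¹‖) fun γ => ?_
    rw [norm_mul, norm_mul, Circle.norm_coe, RCLike.norm_conj, π.norm_eigenvalue hη hu]
    simp
  convert h1 using 2 with γ
  rw [avgProjection_eq_sum, smul_apply, sum_apply,
    map_smul, map_sum, Finset.smul_sum]
  refine Finset.sum_congr rfl fun h _ => ?_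
  rw [smul_apply, map_smul, op_op, smul_smul, smul_smul, Subgroup.coe_mul, mul_assoc]

end Stabilizer

/-! ### From one square-integrable coefficient to a bounded coefficient operator. -/

section SquareIntegrable

variable {G : Type*} [Group G] [MeasurableSpace G] {σ : G → G → Circle}
  {H : Type*} [NormedAddCommGroup H] [InnerProductSpace ℂ H] [CompleteSpace H]
  (π : SigmaRep G σ H)

/-- The matrix coefficient `x ↦ ⟪π(x) g, f⟫`. -/
def coeff (g f : H) (x : G) : ℂ := inner ℂ (π.op x g) f

theorem measurable_coeff (g f : H) : Measurable (π.coeff g f) := π.measurable_inner_op g f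

theorem coeff_op_mul (y x : G) (g f : H) :
    π.coeff g (π.op y f) (y * x) = (σ y x : ℂ) * π.coeff g f x := π.inner_op_mul y x g f

theorem norm_coeff_op (y x : G) (g f : H) :
    ‖π.coeff g (π.op y f) x‖ = ‖π.coeff g f (y⁻¹ * x)‖ := by
  have h := π.coeff_op_mul y (y⁻¹ * x) g f
  rw [mul_inv_cancel_left] at h
  rw [h, norm_mul, Circle.norm_coe, one_mul]

theorem inner_coeff_op_mul (y x : G) (g f h : H) :
    inner ℂ (π.coeff g (π.op y f) (y * x)) (π.coeff g (π.op y h) (y * x))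
      = inner ℂ (π.coeff g f x) (π.coeff g h x) := by
  rw [coeff_op_mul, coeff_op_mul, ← smul_eq_mul, ← smul_eq_mul, inner_smul_left,
    inner_smul_right, ← mul_assoc, mul_comm (starRingEnd ℂ _), Complex.mul_conj,
    Complex.normSq_eq_norm_sq, Circle.norm_coe]
  simp

variable (μ : Measure G)

/-- The graph of the coefficient operator `f ↦ ⟪π(·) g, f⟫`, as a subspace of `H × L²(μ)`. -/
def coeffGraph (g : H) : Submodule ℂ (WithLp 2 (H × Lp ℂ 2 μ)) where
  carrier := {z | z.snd =ᵐ[μ] π.coeff g z.fst}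
  add_mem' := by
    intro a b ha hb
    change ((a.snd + b.snd : Lp ℂ 2 μ) : G → ℂ) =ᵐ[μ] π.coeff g (a.fst + b.fst)
    filter_upwards [ha, hb, Lp.coeFn_add a.snd b.snd] with x h1 h2 h3
    rw [h3, Pi.add_apply, h1, h2]
    exact (inner_add_right _ _ _).symm
  zero_mem' := by
    change ((0 : Lp ℂ 2 μ) : G → ℂ) =ᵐ[μ] π.coeff g 0
    filter_upwards [Lp.coeFn_zero ℂ 2 μ] with x h
    rw [h]
    exact (inner_zero_right _).symm
  smul_mem' := by
    intro c a ha
    change ((c • a.snd : Lp ℂ 2 μ) : G → ℂ) =ᵐ[μ] π.coeff g (c • a.fst)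
    filter_upwards [ha, Lp.coeFn_smul c a.snd] with x h1 h3
    rw [h3, Pi.smul_apply, h1]
    exact (inner_smul_right _ _ _).symm

theorem toLp_mem_coeffGraph {g f : H} (hf : MemLp (π.coeff g f) 2 μ) :
    WithLp.toLp 2 (f, hf.toLp) ∈ π.coeffGraph μ g := hf.coeFn_toLp

theorem memLp_of_mem_coeffGraph {g : H} {z : WithLp 2 (H × Lp ℂ 2 μ)}
    (hz : z ∈ π.coeffGraph μ g) : MemLp (π.coeff g z.fst) 2 μ :=
  (memLp_congr_ae hz).1 (Lp.memLp z.snd)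

theorem inner_of_mem_coeffGraph {g : H} {z w : WithLp 2 (H × Lp ℂ 2 μ)}
    (hz : z ∈ π.coeffGraph μ g) (hw : w ∈ π.coeffGraph μ g) :
    inner ℂ z w = inner ℂ z.fst w.fst
      + ∫ x, inner ℂ (π.coeff g z.fst x) (π.coeff g w.fst x) ∂μ := by
  rw [WithLp.prod_inner_apply]
  congr 1
  rw [L2.inner_def]
  refine integral_congr_ae ?_
  filter_upwards [hz, hw] with x h1 h2
  rw [← h1, ← h2]
  rfl

/-- An `L²`-convergent sequence has an almost everywhere convergent subsequence, while coefficients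
converge pointwise in `x`; the two limits agree. -/
theorem isClosed_coeffGraph (g : H) :
    IsClosed (π.coeffGraph μ g : Set (WithLp 2 (H × Lp ℂ 2 μ))) := by
  refine IsSeqClosed.isClosed fun z w hz hzw => ?_
  have h1 : Filter.Tendsto (fun n => (z n).fst) Filter.atTop (𝓝 w.fst) :=
    ((WithLp.fstL 2 ℂ H (Lp ℂ 2 μ)).continuous.tendsto w).comp hzw
  have h2 : Filter.Tendsto (fun n => (z n).snd) Filter.atTop (𝓝 w.snd) :=
    ((WithLp.sndL 2 ℂ H (Lp ℂ 2 μ)).continuous.tendsto w).comp hzw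
  obtain ⟨ns, hns, hae⟩ := (tendstoInMeasure_of_tendsto_Lp h2).exists_seq_tendsto_ae
  have hz' : ∀ᵐ x ∂μ, ∀ n, (z n).snd x = π.coeff g (z n).fst x := ae_all_iff.2 hz
  change w.snd =ᵐ[μ] π.coeff g w.fst
  filter_upwards [hae, hz'] with x hx hx'
  refine tendsto_nhds_unique hx ?_
  simp only [hx']
  exact Filter.Tendsto.inner tendsto_const_nhds (h1.comp hns.tendsto_atTop)

instance (g : H) : CompleteSpace (π.coeffGraph μ g) :=
  (π.isClosed_coeffGraph μ g).completeSpace_coe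

/-- The compression to `H` of the orthogonal projection of `H × L²(μ)` onto the graph of the
coefficient operator of `g`. -/
def coeffCompression (g f : H) : H :=
  ((π.coeffGraph μ g).starProjection (WithLp.toLp 2 (f, 0))).fst

theorem inner_coeffCompression_left (g f h : H) :
    inner ℂ (π.coeffCompression μ g f) h = inner ℂ f (π.coeffCompression μ g h) := by
  have h1 := (π.coeffGraph μ g).inner_starProjection_left_eq_right
    (WithLp.toLp 2 (f, 0)) (WithLp.toLp 2 (h, 0))
  simpa [WithLp.prod_inner_apply, coeffCompression] using h1

theorem lintegral_coeff_coeffCompression_le (g f : H) :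
    ∫⁻ x, ‖π.coeff g (π.coeffCompression μ g f) x‖ₑ ^ 2 ∂μ ≤ ‖f‖ₑ ^ 2 := by
  set z := (π.coeffGraph μ g).starProjection (WithLp.toLp 2 (f, 0)) with hz
  have hmem : z ∈ π.coeffGraph μ g := Submodule.starProjection_apply_mem _ _
  have h1 : ‖z‖ ≤ ‖f‖ := by
    have := (π.coeffGraph μ g).norm_starProjection_apply_le (WithLp.toLp 2 (f, (0 : Lp ℂ 2 μ)))
    simpa using this
  have h2 : ‖z.snd‖ ≤ ‖f‖ := by
    refine le_trans ?_ h1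
    have := WithLp.prod_norm_sq_eq_of_L2 z
    exact abs_le_of_sq_le_sq' (by nlinarith [sq_nonneg ‖z.fst‖]) (norm_nonneg _) |>.2
  have h3 : eLpNorm z.snd 2 μ ≤ ‖f‖ₑ := by
    rw [← Lp.enorm_def]
    exact enorm_le_iff_norm_le.2 h2
  have h4 : ∫⁻ x, ‖π.coeff g z.fst x‖ₑ ^ 2 ∂μ = eLpNorm z.snd 2 μ ^ 2 := by
    rw [eLpNorm_congr_ae hmem, eLpNorm_eq_lintegral_rpow_enorm_toReal (by simp) (by simp)]
    simp only [ENNReal.toReal_ofNat, ENNReal.rpow_ofNat]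
    rw [← ENNReal.rpow_natCast, ← ENNReal.rpow_mul]
    norm_num
  calc _ = eLpNorm z.snd 2 μ ^ 2 := h4
    _ ≤ _ := by gcongr

/-- Otherwise the projection `z` of `(g, 0)` has `‖z‖² = ⟪z, (g, 0)⟫ = 0`, so `(g, 0)` is orthogonal
to the graph. The graph contains a point with first component `g`, forcing `‖g‖² = 0`. -/
theorem coeffCompression_self_ne_zero {g : H} (hg : g ≠ 0) (hm : MemLp (π.coeff g g) 2 μ) :
    π.coeffCompression μ g g ≠ 0 := by
  intro h0
  set z := (π.coeffGraph μ g).starProjection (WithLp.toLp 2 (g, 0)) with hz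
  have h1 : inner ℂ z (WithLp.toLp 2 (g, (0 : Lp ℂ 2 μ))) = 0 := by
    rw [WithLp.prod_inner_apply]
    change inner ℂ (π.coeffCompression μ g g) g + inner ℂ z.snd 0 = 0
    rw [h0, inner_zero_left, inner_zero_right, add_zero]
  have h2 : z = 0 := by
    rw [← inner_self_eq_zero (𝕜 := ℂ)]
    conv_lhs => arg 2; rw [hz]
    rw [← Submodule.inner_starProjection_left_eq_right,
      Submodule.starProjection_eq_self_iff.2 (Submodule.starProjection_apply_mem _ _), h1]
  have h3 := (π.coeffGraph μ g).starProjection_inner_eq_zero (WithLp.toLp 2 (g, 0)) _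
      (π.toLp_mem_coeffGraph μ hm)
  rw [← hz, h2, sub_zero, WithLp.prod_inner_apply] at h3
  simp only [inner_zero_left, add_zero] at h3
  exact hg (inner_self_eq_zero.1 h3)

variable [MeasurableMul G] [μ.IsMulLeftInvariant]

theorem memLp_coeff_op_iff (y : G) (g f : H) :
    MemLp (π.coeff g (π.op y f)) 2 μ ↔ MemLp (π.coeff g f) 2 μ := by
  rw [memLp_two_iff_integrable_sq_norm (π.measurable_coeff _ _).aestronglyMeasurable,
    memLp_two_iff_integrable_sq_norm (π.measurable_coeff _ _).aestronglyMeasurable]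
  simp only [norm_coeff_op]
  refine ⟨fun h => ?_, fun h => h.comp_mul_left y⁻¹⟩
  simpa using h.comp_mul_left y

theorem integral_inner_coeff_op (y : G) (g f h : H) :
    ∫ x, inner ℂ (π.coeff g (π.op y f) x) (π.coeff g (π.op y h) x) ∂μ
      = ∫ x, inner ℂ (π.coeff g f x) (π.coeff g h x) ∂μ := by
  rw [← integral_mul_left_eq_self _ y]
  simp only [inner_coeff_op_mul]

/-- Acting by `π(y)` on the first component preserves the graph and its inner product: the
coefficient functions are only left-translated and multiplied by a phase that cancels in the
pairing. -/
theorem coeffCompression_op (y : G) (g f : H) :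
    π.coeffCompression μ g (π.op y f) = π.op y (π.coeffCompression μ g f) := by
  set z := (π.coeffGraph μ g).starProjection (WithLp.toLp 2 (f, 0)) with hz
  have hmem : z ∈ π.coeffGraph μ g := Submodule.starProjection_apply_mem _ _
  have hm := (π.memLp_coeff_op_iff μ y g z.fst).2 (π.memLp_of_mem_coeffGraph μ hmem)
  have key : (π.coeffGraph μ g).starProjection (WithLp.toLp 2 (π.op y f, 0))
      = WithLp.toLp 2 (π.op y z.fst, hm.toLp) := by
    refine Submodule.eq_starProjection_of_mem_of_inner_eq_zero (π.toLp_mem_coeffGraph μ hm) ?_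
    intro w hw
    obtain ⟨k, hk⟩ := π.op_surjective y w.fst
    have hkm : MemLp (π.coeff g k) 2 μ := by
      rw [← π.memLp_coeff_op_iff μ y, hk]
      exact π.memLp_of_mem_coeffGraph μ hw
    have h0 := (π.coeffGraph μ g).starProjection_inner_eq_zero (WithLp.toLp 2 (f, 0)) _
      (π.toLp_mem_coeffGraph μ hkm)
    rw [← hz, inner_sub_left, π.inner_of_mem_coeffGraph μ hmem (π.toLp_mem_coeffGraph μ hkm)] at h0
    rw [inner_sub_left, π.inner_of_mem_coeffGraph μ (π.toLp_mem_coeffGraph μ hm) hw]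
    simp only [WithLp.prod_inner_apply, inner_zero_left, add_zero] at h0 ⊢
    change inner ℂ (π.op y f) w.fst - (inner ℂ (π.op y z.fst) w.fst
      + ∫ x, inner ℂ (π.coeff g (π.op y z.fst) x) (π.coeff g w.fst x) ∂μ) = 0
    rw [← hk, integral_inner_coeff_op, inner_op_op, inner_op_op]
    exact h0
  rw [coeffCompression, key]
  rfl

/-- A square-integrable representation has a nonzero vector all of whose coefficients are
square-integrable, with a uniform bound. -/
theorem IsSquareIntegrable.exists_bounded {π : SigmaRep G σ H} (hπ : π.IsSquareIntegrable μ) :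
    ∃ g : H, g ≠ 0 ∧ ∀ f, ∫⁻ x, ‖π.coeff g f x‖ₑ ^ 2 ∂μ ≤ ‖f‖ₑ ^ 2 := by
  obtain ⟨g, hg, hint⟩ := hπ
  have hm : MemLp (π.coeff g g) 2 μ := by
    rw [memLp_two_iff_integrable_sq_norm (π.measurable_coeff _ _).aestronglyMeasurable]
    refine hint.congr (Filter.Eventually.of_forall fun x => ?_)
    simp only [coeff, norm_inner_symm]
  -- With `P` the compression, self-adjointness and commutation with `π` move `P` from `g` to `f`,
  -- where the coefficient is bounded in `L²`.
  refine ⟨π.coeffCompression μ g g, π.coeffCompression_self_ne_zero μ hg hm, fun f => ?_⟩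
  have h : ∀ x, π.coeff (π.coeffCompression μ g g) f x
      = π.coeff g (π.coeffCompression μ g f) x := by
    intro x
    rw [coeff, coeff, ← coeffCompression_op, inner_coeffCompression_left]
  simp only [h]
  exact π.lintegral_coeff_coeffCompression_le μ g f

end SquareIntegrable

end SigmaRep

/-! ### Local averages of an orbit and their Bessel bounds. -/

/-- Every point has an open neighbourhood of finite measure whose translates by a discrete
subgroup are pairwise disjoint. -/
theorem exists_isOpen_pairwise_disjoint_translates {G : Type*} [Group G] [TopologicalSpace G]
    [IsTopologicalGroup G] [MeasurableSpace G] (μ : Measure G) [IsLocallyFiniteMeasure μ]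
    (Γ : Subgroup G) [DiscreteTopology Γ] (x₀ : G) :
    ∃ U : Set G, x₀ ∈ U ∧ IsOpen U ∧ μ U < ⊤ ∧
      Pairwise (Function.onFun Disjoint fun γ : Γ => (fun x => (γ : G)⁻¹ * x) ⁻¹' U) := by
  obtain ⟨V, hV, hVΓ⟩ := isOpen_induced_iff.1 (isOpen_discrete ({1} : Set Γ))
  have h1V : (1 : G) ∈ V := by
    have : (1 : Γ) ∈ Subtype.val ⁻¹' V := by rw [hVΓ]; rfl
    exact this
  have hcont : Filter.Tendsto (fun p : G × G => p.1 * p.2⁻¹) (𝓝 x₀ ×ˢ 𝓝 x₀) (𝓝 1) := by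
    have h : Continuous fun p : G × G => p.1 * p.2⁻¹ := by fun_prop
    have h2 := h.tendsto (x₀, x₀)
    rwa [mul_inv_cancel, nhds_prod_eq] at h2
  obtain ⟨W, hW, hWV⟩ := Filter.mem_prod_same_iff.1 (hcont (hV.mem_nhds h1V))
  obtain ⟨W', hW'W, hW', hxW'⟩ := mem_nhds_iff.1 hW
  obtain ⟨O, hxO, hO, hOμ⟩ := μ.exists_isOpen_measure_lt_top x₀
  refine ⟨W' ∩ O, ⟨hxW', hxO⟩, hW'.inter hO, (measure_mono Set.inter_subset_right).trans_lt hOμ,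
    fun a b hab => Set.disjoint_left.2 fun x ha hb => hab ?_⟩
  have hmem : ((a : G)⁻¹ * x) * ((b : G)⁻¹ * x)⁻¹ ∈ V :=
    hWV (Set.mk_mem_prod (hW'W ha.1) (hW'W hb.1))
  have hmem' : a⁻¹ * b ∈ Subtype.val ⁻¹' V := by
    have he : ((a : G)⁻¹ * x) * ((b : G)⁻¹ * x)⁻¹ = ((a⁻¹ * b : Γ) : G) := by
      push_cast
      group
    rwa [he] at hmem
  rw [hVΓ] at hmem'
  exact inv_mul_eq_one.1 hmem'

theorem sq_lintegral_le {α : Type*} [MeasurableSpace α] (μ : Measure α) {f : α → ENNReal}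
    (hf : AEMeasurable f μ) : (∫⁻ x, f x ∂μ) ^ 2 ≤ μ Set.univ * ∫⁻ x, f x ^ 2 ∂μ := by
  have h := ENNReal.lintegral_mul_le_Lp_mul_Lq μ Real.HolderConjugate.two_two
    (aemeasurable_const (b := (1 : ENNReal))) hf
  simp only [Pi.mul_apply, one_mul, ENNReal.rpow_ofNat, one_pow, lintegral_one] at h
  calc _ ≤ (μ Set.univ ^ (1 / 2 : ℝ) * (∫⁻ x, f x ^ 2 ∂μ) ^ (1 / 2 : ℝ)) ^ 2 := by gcongr
    _ = _ := by
      rw [mul_pow, ← ENNReal.rpow_natCast, ← ENNReal.rpow_natCast, ← ENNReal.rpow_mul,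
        ← ENNReal.rpow_mul]
      norm_num

namespace SigmaRep

variable {G : Type*} [Group G] [MeasurableSpace G] {σ : G → G → Circle}
  {H : Type*} [NormedAddCommGroup H] [InnerProductSpace ℂ H] [CompleteSpace H]
  (π : SigmaRep G σ H)

section Averages

variable (μ : Measure G)

theorem norm_coeff_le (g f : H) (x : G) : ‖π.coeff g f x‖ ≤ ‖g‖ * ‖f‖ := by
  have := norm_inner_le_norm (𝕜 := ℂ) (π.op x g) f
  rwa [norm_op] at this

theorem integrableOn_coeff (g f : H) {E : Set G} (hE : μ E < ⊤) :
    IntegrableOn (π.coeff g f) E μ :=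
  Measure.integrableOn_of_bounded hE.ne (π.measurable_coeff g f).aestronglyMeasurable
    (Filter.Eventually.of_forall (π.norm_coeff_le g f))

/-- The weak integral `∫_E π(x) g dμ(x)`. -/
theorem exists_inner_eq_setIntegral_coeff (g : H) {E : Set G} (hE : μ E < ⊤) :
    ∃ v : H, ∀ f, inner ℂ v f = ∫ x in E, π.coeff g f x ∂μ := by
  let L : H →ₗ[ℂ] ℂ :=
    { toFun := fun f => ∫ x in E, π.coeff g f x ∂μ
      map_add' := fun f h => by
        rw [← integral_add (π.integrableOn_coeff μ g f hE) (π.integrableOn_coeff μ g h hE)]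
        simp only [coeff, inner_add_right]
      map_smul' := fun c f => by
        simp only [coeff, inner_smul_right, RingHom.id_apply, smul_eq_mul]
        rw [integral_const_mul] }
  let L' : H →L[ℂ] ℂ := L.mkContinuous (‖g‖ * μ.real E) fun f => by
    refine (norm_setIntegral_le_of_norm_le_const hE fun x _ => π.norm_coeff_le g f x).trans_eq ?_
    ring
  exact ⟨(InnerProductSpace.toDual ℂ H).symm L', fun f => InnerProductSpace.toDual_symm_apply⟩

variable [MeasurableMul G] [μ.IsMulLeftInvariant]

theorem setLIntegral_coeff_op (g f : H) (y : G) {E : Set G} (hE : MeasurableSet E) :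
    ∫⁻ x in E, ‖π.coeff g f x‖ₑ ^ 2 ∂μ
      = ∫⁻ x in (fun x => y⁻¹ * x) ⁻¹' E, ‖π.coeff g (π.op y f) x‖ₑ ^ 2 ∂μ := by
  rw [← lintegral_indicator hE, ← lintegral_indicator (measurable_const_mul y⁻¹ hE),
    ← lintegral_mul_left_eq_self _ y⁻¹]
  congr 1
  ext x
  by_cases hx : y⁻¹ * x ∈ E
  · have hx' : x ∈ (fun x => y⁻¹ * x) ⁻¹' E := hx
    rw [Set.indicator_of_mem hx, Set.indicator_of_mem hx', ← ofReal_norm, ← ofReal_norm,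
      norm_coeff_op]
  · have hx' : x ∉ (fun x => y⁻¹ * x) ⁻¹' E := hx
    rw [Set.indicator_of_notMem hx, Set.indicator_of_notMem hx']

/-- Weak integrals of an orbit of a vector with bounded coefficient operator have Bessel orbits
under `Γ`. -/
theorem isBessel_op_of_inner_eq_setIntegral {Γ : Subgroup G} {g : H}
    (hg : ∀ f, ∫⁻ x, ‖π.coeff g f x‖ₑ ^ 2 ∂μ ≤ ‖f‖ₑ ^ 2) {E : Set G} (hE : MeasurableSet E)
    (hμE : μ E < ⊤)
    (hd : Pairwise (Function.onFun Disjoint fun γ : Γ => (fun x => (γ : G)⁻¹ * x) ⁻¹' E))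
    {v : H} (hv : ∀ f, inner ℂ v f = ∫ x in E, π.coeff g f x ∂μ) :
    IsBessel fun γ : Γ => π.op (γ : G) v := by
  refine ⟨μ.real E, fun f s => ?_⟩
  have hterm : ∀ γ : Γ, ‖inner ℂ (π.op (γ : G) v) f‖ₑ ^ 2
      ≤ μ E * ∫⁻ x in (fun x => (γ : G)⁻¹ * x) ⁻¹' E, ‖π.coeff g f x‖ₑ ^ 2 ∂μ := by
    intro γ
    -- Writing the test vector as `π(γ) f` moves the integral over `E` to its translate by `γ`.
    obtain ⟨f, rfl⟩ := π.op_surjective (γ : G) f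
    rw [inner_op_op, hv, ← π.setLIntegral_coeff_op μ g f γ hE]
    calc _ ≤ (∫⁻ x in E, ‖π.coeff g f x‖ₑ ∂μ) ^ 2 := by
          gcongr
          exact enorm_integral_le_lintegral_enorm _
      _ ≤ _ := by
          refine (sq_lintegral_le _ (π.measurable_coeff g f).enorm.aemeasurable).trans_eq ?_
          rw [Measure.restrict_apply_univ]
  have hsum : ∑ γ ∈ s, ‖inner ℂ (π.op (γ : G) v) f‖ₑ ^ 2 ≤ μ E * ‖f‖ₑ ^ 2 :=
    calc _ ≤ ∑ γ ∈ s, μ E * ∫⁻ x in (fun x => (γ : G)⁻¹ * x) ⁻¹' E, ‖π.coeff g f x‖ₑ ^ 2 ∂μ :=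
          Finset.sum_le_sum fun γ _ => hterm γ
      _ = μ E * ∫⁻ x in ⋃ γ ∈ s, (fun x => (γ : G)⁻¹ * x) ⁻¹' E, ‖π.coeff g f x‖ₑ ^ 2 ∂μ := by
          rw [← Finset.mul_sum, lintegral_biUnion_finset (hd.set_pairwise _)
            fun γ _ => measurable_const_mul _ hE]
      _ ≤ _ := by
          gcongr
          exact (setLIntegral_le_lintegral _ _).trans (hg f)
  have hfin : μ E * ‖f‖ₑ ^ 2 ≠ ⊤ :=
    ENNReal.mul_ne_top hμE.ne (ENNReal.pow_ne_top enorm_ne_top)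
  have h := ENNReal.toReal_mono hfin hsum
  rw [ENNReal.toReal_sum fun γ _ => ENNReal.pow_ne_top enorm_ne_top, ENNReal.toReal_mul] at h
  simpa [Measure.real] using h

end Averages

/-! ### Totality of the Bessel vectors. -/

section Total

/-- For an irreducible representation, a vector whose coefficient against some `g ≠ 0` vanishes
almost everywhere is zero. -/
theorem IsIrreducible.eq_zero_of_coeff_ae_eq_zero {π : SigmaRep G σ H} (hπ : π.IsIrreducible)
    [TopologicalSpace.SeparableSpace H] [MeasurableMul G] (μ : Measure G) [μ.IsMulLeftInvariant]
    [NeZero μ] {g f : H} (hg : g ≠ 0) (hf : π.coeff g f =ᵐ[μ] 0) : f = 0 := by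
  let K : Submodule ℂ H :=
    { carrier := {f | π.coeff g f =ᵐ[μ] 0}
      add_mem' := fun {a b} ha hb => by
        change π.coeff g (a + b) =ᵐ[μ] 0
        filter_upwards [ha, hb] with x h1 h2
        refine (inner_add_right _ _ _).trans ?_
        change π.coeff g a x + π.coeff g b x = 0
        simp [h1, h2]
      zero_mem' := by
        change π.coeff g 0 =ᵐ[μ] 0
        exact Filter.Eventually.of_forall fun x => inner_zero_right _
      smul_mem' := fun c a ha => by
        change π.coeff g (c • a) =ᵐ[μ] 0
        filter_upwards [ha] with x h1
        refine (inner_smul_right _ _ _).trans ?_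
        change c * π.coeff g a x = 0
        simp [h1] }
  have hK : IsClosed (K : Set H) := by
    refine IsSeqClosed.isClosed fun z w hz hzw => ?_
    change π.coeff g w =ᵐ[μ] 0
    filter_upwards [ae_all_iff.2 hz] with x hx
    refine tendsto_nhds_unique (Filter.Tendsto.inner tendsto_const_nhds hzw) ?_
    exact tendsto_const_nhds.congr fun n => (hx n).symm
  have hinv : ∀ y : G, ∀ f ∈ K, π.op y f ∈ K := by
    intro y f hf
    change π.coeff g (π.op y f) =ᵐ[μ] 0
    filter_upwards [(measurePreserving_mul_left μ y⁻¹).quasiMeasurePreserving.ae hf] with x hx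
    rw [Pi.zero_apply, ← norm_eq_zero, norm_coeff_op, norm_eq_zero]
    exact hx
  rcases hπ.2 K hK hinv with h | h
  · have : f ∈ K := hf
    rwa [h, Submodule.mem_bot] at this
  · exfalso
    -- Separability reduces to countably many null sets, so one `x` has `π(x) g` orthogonal to a
    -- dense set.
    have hall : ∀ᵐ x ∂μ, ∀ n, π.coeff g (TopologicalSpace.denseSeq H n) x = 0 :=
      ae_all_iff.2 fun n => by
        have : TopologicalSpace.denseSeq H n ∈ K := by rw [h]; trivial
        exact this
    obtain ⟨x, hx⟩ := hall.exists
    have h0 : π.op x g = 0 := by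
      refine ext_inner_right ℂ fun k => ?_
      rw [inner_zero_left]
      have hc : Continuous fun k : H => (inner ℂ (π.op x g) k : ℂ) := by fun_prop
      exact congrFun ((TopologicalSpace.denseRange_denseSeq H).equalizer hc continuous_const
        (funext hx)) k
    have := π.norm_op x g
    rw [h0, norm_zero] at this
    exact hg (norm_eq_zero.1 this.symm)

variable [TopologicalSpace G] [IsTopologicalGroup G] [LocallyCompactSpace G]
  [SecondCountableTopology G] [BorelSpace G] [TopologicalSpace.SeparableSpace H]

/-- For a discrete series representation and a discrete subgroup `Γ`, the vectors with Bessel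
orbits under `Γ` are total. -/
theorem IsDiscreteSeries.eq_zero_of_forall_isBessel {π : SigmaRep G σ H} (μ : Measure G)
    [μ.IsHaarMeasure] (hπ : π.IsDiscreteSeries μ) (Γ : Subgroup G) [DiscreteTopology Γ] {f : H}
    (hf : ∀ v : H, IsBessel (fun γ : Γ => π.op (γ : G) v) → inner ℂ v f = 0) : f = 0 := by
  obtain ⟨g, hg, hbd⟩ := hπ.2.exists_bounded μ
  refine hπ.1.eq_zero_of_coeff_ae_eq_zero μ hg ?_
  refine measure_null_of_locally_null _ fun x₀ _ => ?_
  obtain ⟨U, hxU, hU, hUμ, hd⟩ := exists_isOpen_pairwise_disjoint_translates μ Γ x₀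
  refine ⟨_, Filter.inter_mem self_mem_nhdsWithin (mem_nhdsWithin_of_mem_nhds (hU.mem_nhds hxU)),
    ?_⟩
  have hae : π.coeff g f =ᵐ[μ.restrict U] 0 := by
    -- Subsets of `U` inherit disjoint translates, so each such integral is a pairing with a Bessel
    -- vector.
    refine ae_eq_zero_of_forall_setIntegral_eq_of_sigmaFinite
      (fun s _ _ => (π.integrableOn_coeff μ g f hUμ).integrableOn) fun s hs _ => ?_
    rw [Measure.restrict_restrict hs]
    have hsU : μ (s ∩ U) < ⊤ := (measure_mono Set.inter_subset_right).trans_lt hUμ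
    obtain ⟨v, hv⟩ := π.exists_inner_eq_setIntegral_coeff μ g hsU
    rw [← hv]
    refine hf v (π.isBessel_op_of_inner_eq_setIntegral μ hbd (hs.inter hU.measurableSet) hsU ?_ hv)
    intro a b hab
    exact (hd hab).mono (Set.preimage_mono Set.inter_subset_right)
      (Set.preimage_mono Set.inter_subset_right)
  have h2 := (ae_restrict_iff' hU.measurableSet).1 hae
  refine measure_mono_null ?_ h2
  rintro x ⟨hx, hxU'⟩ h
  exact hx (h hxU')

end Total

end SigmaRep

end RieszSep

end

/-! ### The separating property. -/

theorem proposition3p5 {G : Type*} [Group G] [TopologicalSpace G] [IsTopologicalGroup G]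
    [LocallyCompactSpace G] [T2Space G] [SecondCountableTopology G]
    [MeasurableSpace G] [BorelSpace G]
    -- a left Haar measure that is also right invariant: `G` is unimodular
    (μ : MeasureTheory.Measure G) [μ.IsHaarMeasure] [μ.IsMulRightInvariant]
    {H : Type*} [NormedAddCommGroup H] [InnerProductSpace ℂ H] [CompleteSpace H]
    [TopologicalSpace.SeparableSpace H]
    (σ : G → G → Circle) (π : RieszSep.SigmaRep G σ H) (hπ : π.IsDiscreteSeries μ)
    (Γ : Subgroup G) (hΓ : RieszSep.IsLattice Γ)
    (η : H) (hη : η ≠ 0) (hfin : Finite (π.projStabilizer Γ η))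
    (u : π.projStabilizer Γ η → ℂ)
    (hu : ∀ γ : π.projStabilizer Γ η, π.op ((γ : Γ) : G) η = u γ • η)
    -- coset representatives of `Γ / Γ_[η]`
    (Λ : Set Γ) (hΛ : Subgroup.IsComplement Λ (π.projStabilizer Γ η : Set Γ))
    (hRiesz : RieszSep.IsRieszSequence (fun γ : Λ => π.op ((γ : Γ) : G) η)) :
    RieszSep.IsSeparatingFor (π.vonNeumann Γ) (π.avgProjection Γ η u) η := by
  have : DiscreteTopology Γ := hΓ.1
  have : Fintype (π.projStabilizer Γ η) := Fintype.ofFinite _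
  have hp := π.isStarProjection_avgProjection hη hu
  have hpη := π.avgProjection_apply_self hη hu
  refine ⟨hp, π.avgProjection_mem_vonNeumann, ⟨η, hpη⟩, ?_⟩
  rintro _ ⟨b, hb, rfl⟩ hbη
  have key : ∀ v : H, RieszSep.IsBessel (fun γ : Γ => π.op (γ : G) v) →
      b (π.avgProjection Γ η u v) = 0 := by
    intro v hv
    obtain ⟨T, hT, hTη⟩ := π.exists_commutant_map_eq hΛ hu hRiesz
      (ζ := π.avgProjection Γ η u v)
      (fun γ => congrArg (fun S : H →L[ℂ] H => S v) (π.op_mul_avgProjection hη hu γ))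
      (π.isBessel_op_avgProjection hη hu hv)
    have hcomm : T (b η) = b (T η) := congrArg (fun S : H →L[ℂ] H => S η) (hb T hT)
    rw [← hTη, ← hcomm]
    have h0 : b η = 0 := by
      have h1 : b (π.avgProjection Γ η u η) = 0 := hbη
      rwa [hpη] at h1
    rw [h0, map_zero]
  -- The range of the adjoint is orthogonal to every Bessel vector, so totality applies.
  have hadj : ContinuousLinearMap.adjoint (b * π.avgProjection Γ η u) = 0 := by
    ext f
    refine hπ.eq_zero_of_forall_isBessel μ Γ fun v hv => ?_
    rw [ContinuousLinearMap.adjoint_inner_right]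
    have h1 : (b * π.avgProjection Γ η u) v = 0 := key v hv
    rw [h1, inner_zero_left]
  rw [← ContinuousLinearMap.adjoint_adjoint (b * π.avgProjection Γ η u), hadj, map_zero]
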